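/- \textbf{Theorem (DPRM).} A \emph{Minsky machine} with $r$ registers is a finite list $P$ of instructions, labelled $1,2,\dots,|P|$, each of the form $\mathrm{INC}\,\alpha$ or $\mathrm{DEC}\,\alpha\,p$ with $\alpha$ one of the $r$ registers and $p\in\mathbb N$. A state consists of a program counter and $r$ register values in $\mathbb N$. If the program counter is the label of $\mathrm{INC}\,\alpha$, one step increases register $\alpha$ and the program counter by one; if it is the label of $\mathrm{DEC}\,\alpha\,p$, one step decreases register $\alpha$ by one and increases the program counter by one when $\alpha>0$, and otherwise sets the program counter to $p$. The machine terminates from a state if after finitely many steps the program counter is not a label of $P$. A machine $P$ with $n+m$ registers \emph{recognises} $R\subseteq\mathbb N^n$ if for all $v\in\mathbb N^n$: $R\,v$ holds if and only if $P$ terminates when started at label $1$ with register contents $(v,0,\dots,0)$ ($m$ spare zero registers). \emph{Polynomials} are the expressions built from variables, parameters and constants in $\mathbb N$ by $+$ and $\times$. (a) For all $n\in\mathbb N$, every relation $R$ on $\mathbb N^n$ that is recognised by a Minsky machine with some number of spare registers is Diophantine: there are $k\in\mathbb N$ and polynomials $p,q$ with $n$ parameters and $k$ variables such that for all $v\in\mathbb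 N^n$ $$R\,v\iff\exists w\in\mathbb N^k,\ p(v,w)=q(v,w).$$ (b) Such an equation can be computed: there is a computable function which maps all $n$, $m$ and every Minsky machine $P$ with $n+m$ registers to a number $k$ and a pair $p,q$ of polynomials with $n$ parameters and $k$ variables such that, whenever $P$ recognises $R\subseteq\mathbb N^n$, one has $R\,v\iff\exists w\in\mathbb N^k,\ p(v,w)=q(v,w)$ for all $v\in\mathbb N^n$. -/

import Mathlib

namespace DPRM

/-! ### Minsky machines -/

/-- Instructions of a Minsky machine with `n` registers. -/
inductive Instr (n : ℕ) : Type
  | inc (a : Fin n) : Instr n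
  | dec (a : Fin n) (p : ℕ) : Instr n

/-- A state: the value of the program counter and the values of the registers. -/
abbrev State (n : ℕ) : Type := ℕ × (Fin n → ℕ)

/-- One computation step of the machine `(s, P)`, whose `k`-th instruction (from `k = 0`) has the
label `s + k`. `inc a` increases register `a` and the program counter; `dec a p` decreases a
nonzero register `a` and increases the program counter, and jumps to `p` if register `a` is `0`. -/
inductive Step {n : ℕ} (s : ℕ) (P : List (Instr n)) : State n → State n → Prop
  | inc {k : ℕ} {v : Fin n → ℕ} {a : Fin n} (h : P[k]? = some (Instr.inc a)) :
      Step s P (s + k, v) (s + k + 1, Function.update v a (v a + 1))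
  | decSucc {k : ℕ} {v : Fin n → ℕ} {a : Fin n} {p x : ℕ}
      (h : P[k]? = some (Instr.dec a p)) (hv : v a = x + 1) :
      Step s P (s + k, v) (s + k + 1, Function.update v a x)
  | decZero {k : ℕ} {v : Fin n → ℕ} {a : Fin n} {p : ℕ}
      (h : P[k]? = some (Instr.dec a p)) (hv : v a = 0) :
      Step s P (s + k, v) (p, v)

/-- `Steps s P k σ τ`: the machine `(s, P)` transforms `σ` into `τ` in exactly `k` steps. -/
inductive Steps {n : ℕ} (s : ℕ) (P : List (Instr n)) : ℕ → State n → State n → Prop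
  | refl (σ : State n) : Steps s P 0 σ σ
  | head {k : ℕ} {σ τ ρ : State n} (h : Step s P σ τ) (hs : Steps s P k τ ρ) :
      Steps s P (k + 1) σ ρ

/-- The label `i` is outside of the code of `(s, P)`. -/
def Out {n : ℕ} (i s : ℕ) (P : List (Instr n)) : Prop :=
  i < s ∨ P.length + s ≤ i

/-- The computation of `(s, P)` from `σ` ends in `τ`. -/
def Output {n : ℕ} (s : ℕ) (P : List (Instr n)) (σ τ : State n) : Prop :=
  (∃ k : ℕ, Steps s P k σ τ) ∧ Out τ.1 s P

/-- The machine `(s, P)` terminates from the state `σ`. -/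
def Terminates {n : ℕ} (s : ℕ) (P : List (Instr n)) (σ : State n) : Prop :=
  ∃ τ : State n, Output s P σ τ

/-- The machine `P` with `n + m` registers recognises `R`: started at label `1` on the input `v`
followed by `m` zero registers, the machine `(1, P)` terminates exactly when `R v` holds. -/
def Recognises {n m : ℕ} (P : List (Instr (n + m))) (R : (Fin n → ℕ) → Prop) : Prop :=
  ∀ v : Fin n → ℕ, R v ↔ Terminates 1 P (1, Fin.append v (fun _ : Fin m => 0))

/-- `R` is recognised by some Minsky machine with some number `m` of spare registers. -/
def MMRecognisable {n : ℕ} (R : (Fin n → ℕ) → Prop) : Prop :=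
  ∃ (m : ℕ) (P : List (Instr (n + m))), Recognises P R

/-! ### Single Diophantine equations -/

/-- Polynomial expressions over `ℕ` with variables in `U` and parameters in `V`. -/
inductive Poly (U V : Type) : Type
  | var (u : U) : Poly U V
  | param (x : V) : Poly U V
  | const (c : ℕ) : Poly U V
  | add (p q : Poly U V) : Poly U V
  | mul (p q : Poly U V) : Poly U V

/-- The value of a polynomial for the parameters `v` and the variables `w`. -/
def Poly.eval {U V : Type} (v : V → ℕ) (w : U → ℕ) : Poly U V → ℕ
  | .var u => w u
  | .param x => v x
  | .const c => c
  | .add p q => p.eval v w + q.eval v w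
  | .mul p q => p.eval v w * q.eval v w

/-- A single Diophantine equation `lhs = rhs`. -/
structure DioEq (U V : Type) : Type where
  lhs : Poly U V
  rhs : Poly U V

/-- `E` has a solution in natural numbers for the parameters `v`. -/
def DioEq.Solvable {U V : Type} (E : DioEq U V) (v : V → ℕ) : Prop :=
  ∃ w : U → ℕ, E.lhs.eval v w = E.rhs.eval v w

/-- `R` is Diophantine: it is the set of parameters for which some single Diophantine equation,
with `n` parameters and finitely many variables, is solvable. -/
def Diophantine {n : ℕ} (R : (Fin n → ℕ) → Prop) : Prop :=
  ∃ (m : ℕ) (E : DioEq (Fin m) (Fin n)), ∀ v : Fin n → ℕ, R v ↔ E.Solvable v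

/-! ### Computability of translations from machines to equations -/

/-- The code of an instruction. -/
def Instr.code {n : ℕ} : Instr n → ℕ × Option ℕ
  | .inc a => (a, none)
  | .dec a p => (a, some p)

/-- The code of a machine: its list of instruction codes. -/
def machineCode {n : ℕ} (P : List (Instr n)) : List (ℕ × Option ℕ) :=
  P.map Instr.code

/-- The code of a polynomial: its list of symbols in prefix (Polish) notation. -/
def Poly.code {m n : ℕ} : Poly (Fin m) (Fin n) → List (ℕ × ℕ)
  | .var u => [(0, u)]
  | .param x => [(1, x)]
  | .const c => [(2, c)]
  | .add p q => (3, 0) :: (p.code ++ q.code)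
  | .mul p q => (4, 0) :: (p.code ++ q.code)

/-- Machine codes are unambiguous. -/
theorem machineCode_injective {n : ℕ} :
    Function.Injective (machineCode : List (Instr n) → List (ℕ × Option ℕ)) := by
  refine List.map_injective_iff.mpr fun a b h => ?_
  cases a <;> cases b <;> simp_all [Instr.code, Fin.ext_iff]

/-- Prefix codes of polynomials can be parsed in only one way. -/
theorem Poly.code_append_inj {m n : ℕ} (p : Poly (Fin m) (Fin n)) :
    ∀ (q : Poly (Fin m) (Fin n)) (l l' : List (ℕ × ℕ)),
      p.code ++ l = q.code ++ l' → p = q ∧ l = l' := by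
  induction p with
  | var u => intro q l l' h; cases q <;> simp_all [Poly.code, Fin.ext_iff]
  | param x => intro q l l' h; cases q <;> simp_all [Poly.code, Fin.ext_iff]
  | const c => intro q l l' h; cases q <;> simp_all [Poly.code]
  | add p₁ p₂ h₁ h₂ =>
    intro q l l' h
    cases q <;> simp [Poly.code] at h
    obtain ⟨e, h⟩ := h₁ _ _ _ h
    obtain ⟨e', h⟩ := h₂ _ _ _ h
    exact ⟨by rw [e, e'], h⟩
  | mul p₁ p₂ h₁ h₂ =>
    intro q l l' h
    cases q <;> simp [Poly.code] at h
    obtain ⟨e, h⟩ := h₁ _ _ _ h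
    obtain ⟨e', h⟩ := h₂ _ _ _ h
    exact ⟨by rw [e, e'], h⟩

/-- Polynomial codes are unambiguous. -/
theorem Poly.code_injective {m n : ℕ} :
    Function.Injective (Poly.code : Poly (Fin m) (Fin n) → List (ℕ × ℕ)) := fun p q h =>
  (Poly.code_append_inj p q [] [] (by rw [h])).1

/-- A translation takes the number `n` of inputs, the number `m` of spare registers and a machine
with `n + m` registers, and returns a number of variables together with a single Diophantine
equation with that many variables and `n` parameters. -/
abbrev Translation : Type :=
  (n m : ℕ) → List (Instr (n + m)) → (k : ℕ) × DioEq (Fin k) (Fin n)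

/-- The translation `F` is computable: some (total) recursive function computes, from `n`, `m` and
the code of the machine, the number of variables and the codes of the two sides. -/
def Translation.IsComputable (F : Translation) : Prop :=
  ∃ g : ℕ × ℕ × List (ℕ × Option ℕ) → ℕ × List (ℕ × ℕ) × List (ℕ × ℕ),
    Computable g ∧
      ∀ (n m : ℕ) (P : List (Instr (n + m))),
        g (n, m, machineCode P) = ((F n m P).1, (F n m P).2.lhs.code, (F n m P).2.rhs.code)

end DPRM

/-!
A single equation serves for all machines. The halting problem "`x` codes a machine and an input on
which it halts" is recursively enumerable, and every recursively enumerable set of natural numbers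
is Diophantine, so there is an equation `E` with one parameter `x` which is solvable exactly when
`x` is such a code. If the code of a pair (machine, input) is a polynomial in the input with
coefficients computed from the machine, then inserting this polynomial for `x` in `E` yields the
equation for the given machine (`substTranslation_solvable`). The translation is computable because
on prefix codes it only replaces the symbols for `x` by a word that is primitive recursive in the
machine (`substTranslation_isComputable`). Hence the pairing function is `(a + b) ^ 2 + a`, which is
a polynomial over `ℕ`, and not `Nat.pair`.

That recursively enumerable sets are Diophantine (`dioph_of_rePred`) follows Davis, Putnam, Robinson
and Matiyasevich. Mathlib has the Diophantine sets and the theorem that exponentiation is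
Diophantine. Binomial coefficients are digits of `(b + 1) ^ n` in base `b`, and factorials are
obtained from powers and binomial coefficients. The main step is bounded universal quantification
(`DioEq.forall_lt_solvable_iff`, `forall_lt_dioph`). The solutions of the equations for
`k = 0, …, y - 1` are combined by the Chinese remainder theorem, modulo the numbers
`m k = 1 + q / (k + 1)` with `q = N ! ^ 2`, where `N` bounds every number in question. These moduli
are pairwise coprime and have no prime factors up to `N`, their product is the binomial coefficient
`(q + y).choose y`, and some number `c` is congruent to `k` modulo `m k` for all `k`. So a single
congruence for the product expresses all the equations, and the condition that the product divides
`a.choose (B + 1)` expresses that `a` is congruent to a number up to `B` modulo a prime factor of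
each `m k`. Bounded quantification and Gödel's `β` function yield, by induction, that the graph of
every partial recursive function is Diophantine (`dioph_of_partrec`).

The recursive enumerability of the halting problem (`rePred_universalHalts`) is shown with a
primitive recursive interpreter of machine codes, `codeStep`.
-/

namespace DPRM

open Finset Dioph Encodable

/-! ### Binomial coefficients, factorials and coprime moduli -/

/-- Reading off the `k`-th digit of a number given by its digits in base `b`. -/
theorem sum_digits_div_mod {b : ℕ} (k : ℕ) : ∀ (N : ℕ) (f : ℕ → ℕ), (∀ i, f i < b) →
    (∀ i, N ≤ i → f i = 0) → (∑ i ∈ range N, f i * b ^ i) / b ^ k % b = f k := by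
  induction k with
  | zero =>
    intro N f hf h0
    cases N with
    | zero => simp [h0 0 le_rfl]
    | succ N =>
      rw [sum_range_succ']
      simp only [pow_succ, ← mul_assoc, ← sum_mul, pow_zero, mul_one, Nat.div_one]
      rw [Nat.mul_add_mod_self_right, Nat.mod_eq_of_lt (hf 0)]
  | succ k ih =>
    intro N f hf h0
    cases N with
    | zero => simp [h0 (k + 1) (Nat.zero_le _)]
    | succ N =>
      have hb : 0 < b := (Nat.zero_le _).trans_lt (hf 0)
      rw [sum_range_succ', pow_succ' b k, ← Nat.div_div_eq_div_mul]
      simp only [pow_succ, ← mul_assoc, ← sum_mul, pow_zero, mul_one]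
      rw [Nat.add_comm, Nat.add_mul_div_right _ _ hb, Nat.div_eq_of_lt (hf 0), zero_add]
      exact ih N (fun i => f (i + 1)) (fun i => hf _) fun i hi => h0 _ (by omega)

/-- The binomial coefficients `n.choose k` are the digits of `(b + 1) ^ n` in base `b = 2 ^ n + 1`. -/
theorem choose_eq_div_mod (n k : ℕ) :
    n.choose k = (2 ^ n + 2) ^ n / (2 ^ n + 1) ^ k % (2 ^ n + 1) := by
  have h : (2 ^ n + 2) ^ n = ∑ i ∈ range (n + 1), n.choose i * (2 ^ n + 1) ^ i := by
    rw [show 2 ^ n + 2 = (2 ^ n + 1) + 1 by rfl, add_pow]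
    simp [mul_comm]
  rw [h, sum_digits_div_mod k (n + 1) n.choose (fun i => Nat.lt_succ_of_le (Nat.choose_le_two_pow n i))
    fun i hi => Nat.choose_eq_zero_of_lt hi]

/-- A lower bound `r ^ k * (1 - k ^ 2 / r)` for the falling factorial, multiplied out. -/
theorem pow_succ_le_mul_descFactorial_add {r : ℕ} (k : ℕ) (hk : k ≤ r) :
    r ^ (k + 1) ≤ r * r.descFactorial k + k * k * r ^ k := by
  induction k with
  | zero => simp
  | succ k ih =>
    have h1 := ih (by omega)
    have h2 : r.descFactorial (k + 1) + k * r.descFactorial k = r * r.descFactorial k := by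
      rw [Nat.descFactorial_succ, ← add_mul, Nat.sub_add_cancel (by omega)]
    have h3 : r.descFactorial k ≤ r ^ k := Nat.descFactorial_le_pow r k
    calc r ^ (k + 1 + 1) = r * r ^ (k + 1) := by ring
      _ ≤ r * (r * r.descFactorial k + k * k * r ^ k) := Nat.mul_le_mul_left _ h1
      _ = r * r.descFactorial (k + 1) + (k * r * r.descFactorial k + k * k * r ^ (k + 1)) := by
        rw [← h2]; ring
      _ ≤ r * r.descFactorial (k + 1) + (k * r * r ^ k + k * k * r ^ (k + 1)) := by gcongr
      _ ≤ r * r.descFactorial (k + 1) + (k + 1) * (k + 1) * r ^ (k + 1) := by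
        rw [show k * r * r ^ k + k * k * r ^ (k + 1) = (k + k * k) * r ^ (k + 1) by ring]
        gcongr
        nlinarith

/-- `n !` is the integer part of `r ^ n / r.choose n` once `r` is large enough. -/
theorem factorial_eq_div (n : ℕ) :
    n.factorial = (2 * (n + 1) ^ (n + 2)) ^ n / (2 * (n + 1) ^ (n + 2)).choose n := by
  set r := 2 * (n + 1) ^ (n + 2) with hr
  have hn : n.factorial ≤ (n + 1) ^ n :=
    (Nat.factorial_le_pow n).trans (Nat.pow_le_pow_left (Nat.le_succ n) n)
  -- the size of `r` that makes `r ^ n / r.choose n` less than `n.factorial + 1`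
  have hlarge : (n.factorial + 1) * (n * n) < r := by
    have h1 : 1 ≤ (n + 1) ^ n := Nat.one_le_pow _ _ (Nat.succ_pos _)
    calc (n.factorial + 1) * (n * n) ≤ (2 * (n + 1) ^ n) * (n * n) := by gcongr; omega
      _ < (2 * (n + 1) ^ n) * ((n + 1) * (n + 1)) := by
        apply Nat.mul_lt_mul_of_pos_left <;> nlinarith
      _ = r := by rw [hr]; ring
  have hnr : n ≤ r := by
    have := Nat.factorial_pos n
    nlinarith
  have hD := Nat.descFactorial_eq_factorial_mul_choose r n
  have hle : r.descFactorial n ≤ r ^ n := Nat.descFactorial_le_pow r n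
  have hkey := pow_succ_le_mul_descFactorial_add n hnr
  have hrpos : 0 < r := by positivity
  symm
  refine Nat.div_eq_of_lt_le (by rw [← hD]; exact hle) ?_
  have hpow : 0 < r ^ n := by positivity
  have h3 : n.factorial * (r * r ^ n) < n.factorial * (r * ((n.factorial + 1) * r.choose n)) := by
    rw [show n.factorial * (r * ((n.factorial + 1) * r.choose n))
      = (n.factorial + 1) * (r * r.descFactorial n) by rw [hD]; ring]
    have h4 : (n.factorial + 1) * r ^ (n + 1) ≤
        (n.factorial + 1) * (r * r.descFactorial n) + (n.factorial + 1) * (n * n) * r ^ n := by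
      calc _ ≤ (n.factorial + 1) * (r * r.descFactorial n + n * n * r ^ n) :=
            Nat.mul_le_mul_left _ hkey
        _ = _ := by ring
    have h5 : (n.factorial + 1) * (n * n) * r ^ n < r * r ^ n :=
      Nat.mul_lt_mul_of_pos_right hlarge hpow
    rw [pow_succ'] at h4
    linarith
  have h6 := Nat.lt_of_mul_lt_mul_left (Nat.lt_of_mul_lt_mul_left h3)
  simpa using h6

/-- If `q` is divisible by `1, …, y` then `(q + y).choose y` is the product of the numbers
`1 + q / (k + 1)`, `k < y`. -/
theorem choose_add_eq_prod {q y : ℕ} (h : ∀ k < y, k + 1 ∣ q) :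
    (q + y).choose y = ∏ k ∈ range y, (1 + q / (k + 1)) := by
  induction y with
  | zero => simp
  | succ y ih =>
    rw [prod_range_succ, ← ih fun k hk => h k (by omega)]
    apply Nat.eq_of_mul_eq_mul_right (Nat.succ_pos y)
    have h1 := Nat.add_one_mul_choose_eq (q + y) y
    have h2 : q / (y + 1) * (y + 1) = q := Nat.div_mul_cancel (h y (by omega))
    calc (q + (y + 1)).choose (y + 1) * (y + 1) = (q + y + 1) * (q + y).choose y := h1.symm
      _ = (q + y).choose y * (1 * (y + 1) + q / (y + 1) * (y + 1)) := by rw [h2]; ring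
      _ = _ := by simp only [Nat.succ_eq_add_one]; ring

/-- The `k`-th modulus for the bound `N`. For `k < N` these numbers are pairwise coprime and have no
prime factors up to `N`. -/
def modulus (N k : ℕ) : ℕ := 1 + N.factorial * N.factorial / (k + 1)

theorem succ_dvd_factorial {N k : ℕ} (hk : k < N) : k + 1 ∣ N.factorial :=
  Nat.dvd_factorial (Nat.succ_pos k) hk

theorem succ_mul_modulus {N k : ℕ} (hk : k < N) :
    (k + 1) * modulus N k = N.factorial * N.factorial + k + 1 := by
  rw [modulus, mul_add, Nat.mul_div_cancel' ((succ_dvd_factorial hk).mul_right _)]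
  ring

theorem lt_of_prime_dvd_modulus {N k p : ℕ} (hk : k < N) (hp : p.Prime) (h : p ∣ modulus N k) :
    N < p := by
  by_contra! hle
  have h1 : p ∣ N.factorial * N.factorial / (k + 1) := by
    rw [Nat.mul_div_assoc _ (succ_dvd_factorial hk)]
    exact (Nat.dvd_factorial hp.pos hle).mul_right _
  exact hp.one_lt.ne' (Nat.dvd_one.1 ((Nat.dvd_add_left h1).1 h))

theorem coprime_modulus {N k l : ℕ} (hk : k < N) (hl : l < N) (hkl : k ≠ l) :
    (modulus N k).Coprime (modulus N l) := by
  wlog h : k < l generalizing k l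
  · exact (this hl hk hkl.symm (by omega)).symm
  refine Nat.coprime_of_dvd fun p hp h1 h2 => ?_
  have h3 : p ∣ N.factorial * N.factorial + k + 1 := succ_mul_modulus hk ▸ h1.mul_left _
  have h4 : p ∣ N.factorial * N.factorial + l + 1 := succ_mul_modulus hl ▸ h2.mul_left _
  have h5 : p ∣ l - k := by
    have := Nat.dvd_sub h4 h3
    rwa [show N.factorial * N.factorial + l + 1 - (N.factorial * N.factorial + k + 1) = l - k by
      omega] at this
  have := Nat.le_of_dvd (by omega) h5
  have := lt_of_prime_dvd_modulus hk hp h1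
  omega

theorem prod_modulus {N y : ℕ} (hy : y ≤ N) :
    ∏ k ∈ range y, modulus N k = (N.factorial * N.factorial + y).choose y :=
  (choose_add_eq_prod fun _ hk => (succ_dvd_factorial (by omega)).mul_right _).symm

theorem modulus_ne_one {N k : ℕ} (hk : k < N) : modulus N k ≠ 1 := by
  intro h
  have := succ_mul_modulus hk
  have := Nat.mul_pos N.factorial_pos N.factorial_pos
  rw [h] at *
  omega

/-- A prime larger than `B` divides `a.choose (B + 1)` only if `a` is congruent to one of
`0, …, B`. -/
theorem exists_modEq_of_dvd_choose {p a B : ℕ} (hp : p.Prime) (h : p ∣ a.choose (B + 1)) :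
    ∃ u ≤ B, u ≡ a [MOD p] := by
  by_cases ha : a ≤ B
  · exact ⟨a, ha, rfl⟩
  have h1 : p ∣ a.descFactorial (B + 1) := by
    rw [Nat.descFactorial_eq_factorial_mul_choose]
    exact h.mul_left _
  rw [Nat.descFactorial_eq_prod_range, hp.prime.dvd_finsetProd_iff] at h1
  obtain ⟨j, hj, hd⟩ := h1
  rw [mem_range] at hj
  exact ⟨j, by omega, (Nat.modEq_iff_dvd' (by omega)).2 hd⟩

/-- Conversely, a modulus without prime factors up to `B + 1` divides `a.choose (B + 1)` when `a`
is congruent to some `u ≤ B`. -/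
theorem dvd_choose_of_modEq {M a u B : ℕ} (hu : u ≤ B) (h : u ≡ a [MOD M])
    (hM : ∀ p, p.Prime → p ∣ M → B + 1 < p) : M ∣ a.choose (B + 1) := by
  by_cases ha : a ≤ B
  · simp [Nat.choose_eq_zero_of_lt (Nat.lt_succ_of_le ha)]
  have h1 : M ∣ a.descFactorial (B + 1) := by
    rw [Nat.descFactorial_eq_prod_range]
    exact ((Nat.modEq_iff_dvd' (by omega)).1 h).trans
      (dvd_prod_of_mem _ (mem_range.2 (Nat.lt_succ_of_le hu)))
  rw [Nat.descFactorial_eq_factorial_mul_choose] at h1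
  refine Nat.Coprime.dvd_of_dvd_mul_left (Nat.coprime_of_dvd fun p hp h2 h3 => ?_) h1
  have := hM p hp h2
  have := (hp.dvd_factorial).1 h3
  omega

/-! ### Polynomials -/

/-- Simultaneous substitution of polynomials for the variables and the parameters. -/
def Poly.subst {U V U' V' : Type} (σ : U → Poly U' V') (τ : V → Poly U' V') :
    Poly U V → Poly U' V'
  | .var u => σ u
  | .param x => τ x
  | .const c => .const c
  | .add p q => .add (p.subst σ τ) (q.subst σ τ)
  | .mul p q => .mul (p.subst σ τ) (q.subst σ τ)

theorem Poly.eval_subst {U V U' V' : Type} (σ : U → Poly U' V') (τ : V → Poly U' V')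
    (v : V' → ℕ) (w : U' → ℕ) (p : Poly U V) :
    (p.subst σ τ).eval v w = p.eval (fun x => (τ x).eval v w) fun u => (σ u).eval v w := by
  induction p <;> simp_all [Poly.subst, Poly.eval]

theorem Poly.eval_mono {U V : Type} (p : Poly U V) {v v' : V → ℕ} {w w' : U → ℕ}
    (hv : ∀ x, v x ≤ v' x) (hw : ∀ u, w u ≤ w' u) : p.eval v w ≤ p.eval v' w' := by
  induction p with
  | var u => exact hw u
  | param x => exact hv x
  | const c => exact le_rfl
  | add p q hp hq => exact add_le_add hp hq
  | mul p q hp hq => exact Nat.mul_le_mul hp hq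

theorem Poly.eval_modEq {U V : Type} (p : Poly U V) {M : ℕ} {v v' : V → ℕ} {w w' : U → ℕ}
    (hv : ∀ x, v x ≡ v' x [MOD M]) (hw : ∀ u, w u ≡ w' u [MOD M]) :
    p.eval v w ≡ p.eval v' w' [MOD M] := by
  induction p with
  | var u => exact hw u
  | param x => exact hv x
  | const c => rfl
  | add p q hp hq => exact hp.add hq
  | mul p q hp hq => exact hp.mul hq

/-- Only finitely many variables occur in a polynomial. -/
theorem Poly.exists_finset {U V : Type} (p : Poly U V) :
    ∃ s : Finset U, ∀ t : Finset U, s ⊆ t → ∃ p' : Poly t V, ∀ v w,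
      p'.eval v (fun u => w u) = p.eval v w := by
  classical
  induction p with
  | var u => exact ⟨{u}, fun t h => ⟨.var ⟨u, h (by simp)⟩, fun v w => rfl⟩⟩
  | param x => exact ⟨∅, fun t _ => ⟨.param x, fun v w => rfl⟩⟩
  | const c => exact ⟨∅, fun t _ => ⟨.const c, fun v w => rfl⟩⟩
  | add p q hp hq =>
    obtain ⟨s, hs⟩ := hp
    obtain ⟨s', hs'⟩ := hq
    refine ⟨s ∪ s', fun t h => ?_⟩
    obtain ⟨p', hp'⟩ := hs t (subset_union_left.trans h)
    obtain ⟨q', hq'⟩ := hs' t (subset_union_right.trans h)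
    exact ⟨.add p' q', fun v w => by simp [Poly.eval, hp', hq']⟩
  | mul p q hp hq =>
    obtain ⟨s, hs⟩ := hp
    obtain ⟨s', hs'⟩ := hq
    refine ⟨s ∪ s', fun t h => ?_⟩
    obtain ⟨p', hp'⟩ := hs t (subset_union_left.trans h)
    obtain ⟨q', hq'⟩ := hs' t (subset_union_right.trans h)
    exact ⟨.mul p' q', fun v w => by simp [Poly.eval, hp', hq']⟩

theorem exists_eval_sub_of_isPoly {U V : Type} {f : (V ⊕ U → ℕ) → ℤ} (hf : IsPoly f) :
    ∃ p q : Poly U V, ∀ v w, f (Sum.elim v w) = (p.eval v w : ℤ) - q.eval v w := by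
  induction hf with
  | proj i =>
    cases i with
    | inl x => exact ⟨.param x, .const 0, fun v w => by simp [Poly.eval]⟩
    | inr u => exact ⟨.var u, .const 0, fun v w => by simp [Poly.eval]⟩
  | const n =>
    exact ⟨.const n.toNat, .const (-n).toNat, fun v w => (Int.toNat_sub_toNat_neg n).symm⟩
  | sub _ _ hp hq =>
    obtain ⟨p, p', hp⟩ := hp
    obtain ⟨q, q', hq⟩ := hq
    refine ⟨.add p q', .add p' q, fun v w => ?_⟩
    simp only [hp, hq, Poly.eval]
    push_cast
    ring
  | mul _ _ hp hq =>
    obtain ⟨p, p', hp⟩ := hp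
    obtain ⟨q, q', hq⟩ := hq
    refine ⟨.add (.mul p q) (.mul p' q'), .add (.mul p q') (.mul p' q), fun v w => ?_⟩
    simp only [hp, hq, Poly.eval]
    push_cast
    ring

/-- Mathlib's Diophantine sets, which allow integer coefficients and arbitrarily many dummy
variables, are given by an equation between polynomials over `ℕ` in finitely many variables. -/
theorem exists_dioEq_of_dioph {V : Type} {S : Set (V → ℕ)} (h : Dioph S) :
    ∃ (m : ℕ) (E : DioEq (Fin m) V), ∀ v, v ∈ S ↔ E.Solvable v := by
  classical
  obtain ⟨U, f, hf⟩ := h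
  obtain ⟨p, q, hpq⟩ := exists_eval_sub_of_isPoly f.isPoly
  obtain ⟨s, hs⟩ := p.exists_finset
  obtain ⟨s', hs'⟩ := q.exists_finset
  obtain ⟨p', hp⟩ := hs (s ∪ s') subset_union_left
  obtain ⟨q', hq⟩ := hs' (s ∪ s') subset_union_right
  let e := (s ∪ s').equivFin
  refine ⟨_, ⟨p'.subst (fun u => .var (e u)) .param, q'.subst (fun u => .var (e u)) .param⟩,
    fun v => ?_⟩
  rw [hf]
  simp only [DioEq.Solvable, Poly.eval_subst, Poly.eval]
  constructor
  · rintro ⟨w, hw⟩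
    have := (hpq v w).symm.trans hw
    refine ⟨fun i => w (e.symm i), ?_⟩
    simp only [Equiv.symm_apply_apply, hp, hq]
    exact_mod_cast sub_eq_zero.1 this
  · rintro ⟨w, hw⟩
    refine ⟨fun u => if h : u ∈ s ∪ s' then w (e ⟨u, h⟩) else 0, (hpq _ _).trans ?_⟩
    rw [← hp, ← hq, sub_eq_zero, Nat.cast_inj]
    simpa using hw

/-! ### Diophantine functions and predicates -/

section Closure

variable {α : Type}

/-- Existential quantification in the form in which predicates are stated below: the bound variable
is `none`. -/
theorem exists_dioph {p : ℕ → (α → ℕ) → Prop}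
    (h : Dioph {v : Option α → ℕ | p (v none) fun x => v (some x)}) :
    Dioph {v : α → ℕ | ∃ x, p x v} :=
  (ex1_dioph h).ext fun _ => Iff.rfl

theorem choose_diophFn {f g : (α → ℕ) → ℕ} (hf : DiophFn f) (hg : DiophFn g) :
    DiophFn fun v => (f v).choose (g v) := by
  simp only [choose_eq_div_mod]
  have h2 := pow_dioph (const_dioph 2) hf
  have hb := add_dioph h2 (const_dioph 1)
  exact mod_dioph (div_dioph (pow_dioph (add_dioph h2 (const_dioph 2)) hf) (pow_dioph hb hg)) hb

theorem factorial_diophFn {f : (α → ℕ) → ℕ} (hf : DiophFn f) :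
    DiophFn fun v => (f v).factorial := by
  simp only [factorial_eq_div]
  have hr := mul_dioph (const_dioph 2)
    (pow_dioph (add_dioph hf (const_dioph 1)) (add_dioph hf (const_dioph 2)))
  exact div_dioph (pow_dioph hr hf) (choose_diophFn hr hf)

theorem Poly.eval_diophFn {U V : Type} (p : Poly U V) {g : V → (α → ℕ) → ℕ}
    {h : U → (α → ℕ) → ℕ} (hg : ∀ x, DiophFn (g x)) (hh : ∀ u, DiophFn (h u)) :
    DiophFn fun v => p.eval (fun x => g x v) fun u => h u v := by
  induction p with
  | var u => exact hh u
  | param x => exact hg x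
  | const c => exact const_dioph c
  | add p q hp hq => exact add_dioph hp hq
  | mul p q hp hq => exact mul_dioph hp hq

theorem forall_fin_dioph {m : ℕ} {S : Fin m → Set (α → ℕ)} (h : ∀ i, Dioph (S i)) :
    Dioph {v | ∀ i, v ∈ S i} := by
  have := DiophList.forall (List.ofFn S) (List.forall_iff_forall_mem.2 (by simpa using h))
  exact this.ext fun v => by simp [List.forall_iff_forall_mem]

end Closure

/-! ### Bounded universal quantification -/

/-- An upper bound for `y`, for `B + 1` and for the values of both sides of an equation, where the
first parameter is less than `y` and the variables are at most `B`. -/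
def DioEq.bound {α : Type} {m : ℕ} (E : DioEq (Fin m) (Option α)) (v : α → ℕ) (y B : ℕ) : ℕ :=
  E.lhs.eval (Option.elim' y v) (fun _ => B) + E.rhs.eval (Option.elim' y v) (fun _ => B) + y + B + 1

/-- The equations obtained from `E` by putting `0, …, y - 1` for the first parameter are all
solvable if and only if a single system of divisibilities is: its solution `a` represents the
solutions of all the equations by their residues modulo `modulus N k`, `k < y`, whose product is
the binomial coefficient `M`. Every bounded number `u` is recovered from `a` by
the condition that `M` divides `a (a - 1) ⋯ (a - B)`, and the number `c` is congruent to
`k` modulo `modulus N k` for all `k` at once. -/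
theorem DioEq.forall_lt_solvable_iff {α : Type} {m : ℕ} (E : DioEq (Fin m) (Option α))
    (v : α → ℕ) (y : ℕ) :
    (∀ k < y, E.Solvable (Option.elim' k v)) ↔
      ∃ (B : ℕ) (a : Fin m → ℕ),
        let q := (E.bound v y B).factorial * (E.bound v y B).factorial
        let M := (q + y).choose y
        let c := (q + 1) * (M - 1)
        (∀ i, M ∣ (a i).choose (B + 1)) ∧
          E.lhs.eval (Option.elim' c v) a ≡ E.rhs.eval (Option.elim' c v) a [MOD M] := by
  have hc : ∀ {q M : ℕ}, 0 < M → (q + 1) * (M - 1) + (q + 1) = (q + 1) * M := by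
    intro q M hM
    rw [← Nat.mul_succ, Nat.succ_eq_add_one, Nat.sub_add_cancel hM]
  have hy : ∀ B, y ≤ E.bound v y B := fun B => by unfold DioEq.bound; omega
  have hB : ∀ B, B + 1 ≤ E.bound v y B := fun B => by unfold DioEq.bound; omega
  -- `c` is congruent to `k` modulo every divisor of `modulus N k`
  have hck : ∀ {N M k d : ℕ}, k < N → 0 < M → d ∣ M → d ∣ modulus N k →
      (N.factorial * N.factorial + 1) * (M - 1) ≡ k [MOD d] := by
    intro N M k d hk hM hdM hd
    -- after adding `N.factorial ^ 2 + 1` both sides are multiples of `d`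
    refine Nat.ModEq.add_right_cancel' (N.factorial * N.factorial + 1) ?_
    rw [hc hM]
    refine (Nat.modEq_zero_iff_dvd.2 (hdM.mul_left _)).trans (Nat.modEq_zero_iff_dvd.2 ?_).symm
    rw [show k + (N.factorial * N.factorial + 1) = (k + 1) * modulus N k by
      rw [succ_mul_modulus hk]; ring]
    exact hd.mul_left _
  have helim : ∀ {d c k : ℕ}, c ≡ k [MOD d] →
      ∀ x, (Option.elim' c v : Option α → ℕ) x ≡ (Option.elim' k v : Option α → ℕ) x [MOD d] := by
    intro d c k h x
    cases x with
    | none => exact h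
    | some x => rfl
  constructor
  · intro h
    choose! u hu using h
    let B := (range y).sup fun k => univ.sup fun i => u k i
    have huB : ∀ k < y, ∀ i, u k i ≤ B := fun k hk i =>
      (le_sup (f := fun i => u k i) (mem_univ i)).trans
        (le_sup (f := fun k => univ.sup fun i => u k i) (mem_range.2 hk))
    set N := E.bound v y B with hN
    have hyN : y ≤ N := hy B
    have hM : (N.factorial * N.factorial + y).choose y = ∏ k ∈ range y, modulus N k :=
      (prod_modulus hyN).symm
    have hMpos : 0 < (N.factorial * N.factorial + y).choose y := Nat.choose_pos (by omega)
    have hco : (↑(range y) : Set ℕ).Pairwise (Function.onFun Nat.Coprime (modulus N)) :=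
      fun k hk l hl hkl =>
        coprime_modulus ((mem_range.1 hk).trans_le hyN) ((mem_range.1 hl).trans_le hyN) hkl
    have hcrt : ∀ i, ∃ a, ∀ k < y, a ≡ u k i [MOD modulus N k] := fun i =>
      let a := Nat.chineseRemainderOfFinset (fun k => u k i) (modulus N) (range y)
        (fun k _ => by simp [modulus]) hco
      ⟨a, fun k hk => a.2 k (mem_range.2 hk)⟩
    choose a ha using hcrt
    refine ⟨B, a, fun i => ?_, ?_⟩
    · rw [hM]
      refine prod_dvd_of_isRelPrime (fun k hk l hl hkl =>
        Nat.coprime_iff_isRelPrime.1 (hco hk hl hkl)) fun k hk => ?_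
      rw [mem_range] at hk
      exact dvd_choose_of_modEq (huB k hk i) (ha i k hk).symm fun p hp hd =>
        (hB B).trans_lt (lt_of_prime_dvd_modulus (hk.trans_le hyN) hp hd)
    · rw [Nat.modEq_iff_dvd, hM]
      push_cast
      refine prod_dvd_of_coprime (fun k hk l hl hkl =>
        Int.isCoprime_iff_gcd_eq_one.2 (hco hk hl hkl)) fun k hk => ?_
      have hdM : modulus N k ∣ (N.factorial * N.factorial + y).choose y :=
        hM ▸ dvd_prod_of_mem _ hk
      rw [mem_range] at hk
      rw [← hM, ← Nat.modEq_iff_dvd]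
      have h1 := helim (hck (hk.trans_le hyN) hMpos hdM dvd_rfl)
      exact ((E.lhs.eval_modEq h1 fun i => ha i k hk).trans (hu k hk ▸ rfl)).trans
        (E.rhs.eval_modEq h1 fun i => ha i k hk).symm
  · rintro ⟨B, a, h1, h2⟩ k hk
    set N := E.bound v y B with hN
    have hyN : y ≤ N := hy B
    have hkN := hk.trans_le hyN
    have hMpos : 0 < (N.factorial * N.factorial + y).choose y := Nat.choose_pos (by omega)
    -- reduction modulo a prime factor of `modulus N k`: being prime, it selects one factor of
    -- `a i (a i - 1) ⋯ (a i - B)`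
    obtain ⟨p, hp, hpd⟩ := Nat.exists_prime_and_dvd (modulus_ne_one hkN)
    have hpM : p ∣ (N.factorial * N.factorial + y).choose y :=
      hpd.trans (prod_modulus hyN ▸ dvd_prod_of_mem _ (mem_range.2 hk))
    choose u huB hu using fun i => exists_modEq_of_dvd_choose hp (hpM.trans (h1 i))
    refine ⟨u, Nat.ModEq.eq_of_lt_of_lt (m := p) ?_ ?_ ?_⟩
    · have h3 := helim (hck hkN hMpos hpM hpd).symm
      exact ((E.lhs.eval_modEq h3 hu).trans (h2.of_dvd hpM)).trans (E.rhs.eval_modEq h3 hu).symm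
    -- both sides are at most `N`, which is less than `p`
    all_goals
      refine lt_of_le_of_lt ?_ (lt_of_prime_dvd_modulus hkN hp hpd)
      have hx : ∀ x, (Option.elim' k v : Option α → ℕ) x ≤ (Option.elim' y v : Option α → ℕ) x :=
        fun x => by cases x <;> simp [hk.le]
    · refine (E.lhs.eval_mono hx huB).trans ?_
      rw [hN, DioEq.bound]; omega
    · refine (E.rhs.eval_mono hx huB).trans ?_
      rw [hN, DioEq.bound]; omega

theorem Poly.eval_elim_diophFn {α γ U : Type} (p : Poly U (Option α)) {v : α → (γ → ℕ) → ℕ}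
    {k : (γ → ℕ) → ℕ} {u : U → (γ → ℕ) → ℕ} (hv : ∀ x, DiophFn (v x)) (hk : DiophFn k)
    (hu : ∀ i, DiophFn (u i)) :
    DiophFn fun w => p.eval (Option.elim' (k w) fun x => v x w) fun i => u i w := by
  have := p.eval_diophFn (g := Option.elim' k v) (h := u) (fun o => by cases o <;> simp [hv, hk]) hu
  convert this using 4 with w o
  cases o <;> rfl

theorem DioEq.bound_diophFn {α γ : Type} {m : ℕ} (E : DioEq (Fin m) (Option α))
    {v : α → (γ → ℕ) → ℕ} {y B : (γ → ℕ) → ℕ} (hv : ∀ x, DiophFn (v x)) (hy : DiophFn y)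
    (hB : DiophFn B) : DiophFn fun w => E.bound (fun x => v x w) (y w) (B w) :=
  add_dioph (add_dioph (add_dioph (add_dioph (E.lhs.eval_elim_diophFn hv hy fun _ => hB)
    (E.rhs.eval_elim_diophFn hv hy fun _ => hB)) hy) hB) (const_dioph 1)

/-- Diophantine predicates are closed under bounded universal quantification. -/
theorem forall_lt_dioph {α : Type} {p : ℕ → (α → ℕ) → Prop}
    (h : Dioph {v : Option α → ℕ | p (v none) fun x => v (some x)})
    {f : (α → ℕ) → ℕ} (hf : DiophFn f) : Dioph {v : α → ℕ | ∀ k < f v, p k v} := by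
  obtain ⟨m, E, hE⟩ := exists_dioEq_of_dioph h
  suffices H : Dioph {v : α → ℕ | ∀ k < f v, E.Solvable (Option.elim' k v)} from
    H.ext fun v => forall₂_congr fun k _ => (hE (Option.elim' k v)).symm
  simp only [DioEq.forall_lt_solvable_iff]
  refine exists_dioph (ex_dioph (β := Fin m)
    (S := {w : Option α ⊕ Fin m → ℕ |
      let v : α → ℕ := fun x => w (.inl (some x))
      let B := w (.inl none)
      let a : Fin m → ℕ := fun i => w (.inr i)
      let q := (E.bound v (f v) B).factorial * (E.bound v (f v) B).factorial
      let M := (q + f v).choose (f v)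
      let c := (q + 1) * (M - 1)
      (∀ i, M ∣ (a i).choose (B + 1)) ∧
        E.lhs.eval (Option.elim' c v) a ≡ E.rhs.eval (Option.elim' c v) a [MOD M]}) ?_)
  have hv : ∀ x : α, DiophFn fun w : Option α ⊕ Fin m → ℕ => w (.inl (some x)) :=
    fun x => proj_dioph _
  have hB : DiophFn fun w : Option α ⊕ Fin m → ℕ => w (.inl none) := proj_dioph _
  have ha : ∀ i : Fin m, DiophFn fun w : Option α ⊕ Fin m → ℕ => w (.inr i) :=
    fun i => proj_dioph _
  have hf' : DiophFn fun w : Option α ⊕ Fin m → ℕ => f fun x => w (.inl (some x)) :=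
    reindex_diophFn (fun x => Sum.inl (some x)) hf
  have hN := factorial_diophFn (E.bound_diophFn hv hf' hB)
  have hq := mul_dioph hN hN
  have hM := choose_diophFn (add_dioph hq hf') hf'
  have hc := mul_dioph (add_dioph hq (const_dioph 1)) (sub_dioph hM (const_dioph 1))
  exact (forall_fin_dioph fun i =>
    dvd_dioph hM (choose_diophFn (ha i) (add_dioph hB (const_dioph 1)))).inter
    (modEq_dioph (E.lhs.eval_elim_diophFn hv hc ha) (E.rhs.eval_elim_diophFn hv hc ha) hM)

/-! ### Partial recursive functions -/

section Pairing

variable {α : Type}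

/-- Passing to a context with one more variable. -/
theorem diophFn_some {f : (α → ℕ) → ℕ} (hf : DiophFn f) :
    DiophFn fun v : Option α → ℕ => f fun x => v (some x) :=
  reindex_diophFn some hf

theorem pair_diophFn {f g : (α → ℕ) → ℕ} (hf : DiophFn f) (hg : DiophFn g) :
    DiophFn fun v => Nat.pair (f v) (g v) := by
  have hf' := diophFn_some hf
  have hg' := diophFn_some hg
  refine (((lt_dioph hf' hg').inter
    (eq_dioph (add_dioph (mul_dioph hg' hg') hf') (proj_dioph none))).union
    ((le_dioph hg' hf').inter
      (eq_dioph (add_dioph (add_dioph (mul_dioph hf' hf') hf') hg') (proj_dioph none)))).ext ?_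
  intro v
  change ((f fun x => v (some x)) < (g fun x => v (some x)) ∧ _ = _ ∨
    (g fun x => v (some x)) ≤ (f fun x => v (some x)) ∧ _ = _) ↔
    Nat.pair (f fun x => v (some x)) (g fun x => v (some x)) = v none
  unfold Nat.pair
  split_ifs with h
  · simp [h, h.not_ge]
  · simp [h, not_lt.1 h]

theorem unpair_fst_diophFn {f : (α → ℕ) → ℕ} (hf : DiophFn f) :
    DiophFn fun v => (f v).unpair.1 := by
  refine (exists_dioph (p := fun b (v : Option α → ℕ) =>
    (f fun x => v (some x)) = Nat.pair (v none) b)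
    (eq_dioph (diophFn_some (diophFn_some hf))
      (pair_diophFn (proj_dioph (some none)) (proj_dioph none)))).ext fun v => ?_
  change (∃ b, (f fun x => v (some x)) = Nat.pair (v none) b) ↔
    (f fun x => v (some x)).unpair.1 = v none
  constructor
  · rintro ⟨b, h⟩
    rw [h, Nat.unpair_pair]
  · intro h
    exact ⟨_, by rw [← h, Nat.pair_unpair]⟩

theorem unpair_snd_diophFn {f : (α → ℕ) → ℕ} (hf : DiophFn f) :
    DiophFn fun v => (f v).unpair.2 := by
  refine (exists_dioph (p := fun b (v : Option α → ℕ) =>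
    (f fun x => v (some x)) = Nat.pair b (v none))
    (eq_dioph (diophFn_some (diophFn_some hf))
      (pair_diophFn (proj_dioph none) (proj_dioph (some none))))).ext fun v => ?_
  change (∃ b, (f fun x => v (some x)) = Nat.pair b (v none)) ↔
    (f fun x => v (some x)).unpair.2 = v none
  constructor
  · rintro ⟨b, h⟩
    rw [h, Nat.unpair_pair]
  · intro h
    exact ⟨_, by rw [← h, Nat.pair_unpair]⟩

theorem beta_diophFn {f g : (α → ℕ) → ℕ} (hf : DiophFn f) (hg : DiophFn g) :
    DiophFn fun v => Nat.beta (f v) (g v) :=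
  mod_dioph (unpair_fst_diophFn hf)
    (add_dioph (mul_dioph (add_dioph hg (const_dioph 1)) (unpair_snd_diophFn hf)) (const_dioph 1))

end Pairing

/-- The values of a primitive recursion up to `n` are collected in a single number by Gödel's `β`
function. -/
theorem mem_prec_iff (f g : ℕ →. ℕ) (a n z : ℕ) :
    z ∈ (n.rec (f a) fun y IH => IH.bind fun i => g (Nat.pair a (Nat.pair y i)) : Part ℕ) ↔
      ∃ s : ℕ, Nat.beta s 0 ∈ f a ∧
        (∀ y < n, Nat.beta s (y + 1) ∈ g (Nat.pair a (Nat.pair y (Nat.beta s y)))) ∧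
        Nat.beta s n = z := by
  constructor
  · intro h
    have : ∃ l : List ℕ, ∃ hl : l.length = n + 1, l[0] ∈ f a ∧
        (∀ y, ∀ hy : y < n, l[y + 1] ∈ g (Nat.pair a (Nat.pair y l[y]))) ∧ l[n] = z := by
      induction n generalizing z with
      | zero => exact ⟨[z], rfl, by simpa using h, by simp, rfl⟩
      | succ n ih =>
        obtain ⟨i, hi, hz⟩ := Part.mem_bind_iff.1 h
        obtain ⟨l, hl, h0, hs, hn⟩ := ih i hi
        refine ⟨l ++ [z], by simp [hl], ?_, fun y hy => ?_, ?_⟩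
        · rwa [List.getElem_append_left (by omega)]
        · rcases Nat.lt_succ_iff_lt_or_eq.1 hy with hy | rfl
          · rw [List.getElem_append_left (h := by omega), List.getElem_append_left (h := by omega)]
            exact hs y hy
          · simpa [List.getElem_append, hl, hn] using hz
        · rw [List.getElem_append_right (by omega)]
          simp [hl]
    obtain ⟨l, hl, h0, hs, hn⟩ := this
    have hb : ∀ y (hy : y < n + 1), Nat.beta (Nat.unbeta l) y = l[y] := fun y hy =>
      Nat.beta_unbeta_coe l ⟨y, by omega⟩
    refine ⟨Nat.unbeta l, ?_, fun y hy => ?_, ?_⟩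
    · rwa [hb 0 (by omega)]
    · rw [hb y (by omega), hb (y + 1) (by omega)]
      exact hs y hy
    · rwa [hb n (by omega)]
  · rintro ⟨s, h0, hs, rfl⟩
    induction n with
    | zero => exact h0
    | succ n ih =>
      exact Part.mem_bind_iff.2 ⟨_, ih fun y hy => hs y (by omega), hs n (by omega)⟩

/-- The graph of a partial recursive function is Diophantine. -/
theorem dioph_of_partrec {f : ℕ →. ℕ} (hf : Nat.Partrec f) : ∀ {α : Type} {g h : (α → ℕ) → ℕ},
    DiophFn g → DiophFn h → Dioph {v | h v ∈ f (g v)} := by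
  induction hf with
  | zero =>
    intro α g h _ hh
    exact (eq_dioph hh (const_dioph 0)).ext fun v => by simp [pure, PFun.pure]
  | succ =>
    intro α g h hg hh
    exact (eq_dioph hh (add_dioph hg (const_dioph 1))).ext fun v => by simp
  | left =>
    intro α g h hg hh
    exact (eq_dioph hh (unpair_fst_diophFn hg)).ext fun v => by simp
  | right =>
    intro α g h hg hh
    exact (eq_dioph hh (unpair_snd_diophFn hg)).ext fun v => by simp
  | @pair f₁ f₂ _ _ h₁ h₂ =>
    intro α g h hg hh
    refine ((h₁ hg (unpair_fst_diophFn hh)).inter (h₂ hg (unpair_snd_diophFn hh))).ext fun v => ?_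
    simp only [Set.mem_inter_iff, Set.mem_ofPred_eq, Seq.seq, Part.map_eq_map, Part.mem_bind_iff,
      Part.mem_map_iff]
    constructor
    · rintro ⟨h1, h2⟩
      exact ⟨_, ⟨_, h1, rfl⟩, _, h2, Nat.pair_unpair _⟩
    · rintro ⟨_, ⟨a, ha, rfl⟩, b, hb, h⟩
      rw [← h, Nat.unpair_pair]
      exact ⟨ha, hb⟩
  | @comp f₁ f₂ _ _ h₁ h₂ =>
    intro α g h hg hh
    refine (exists_dioph (p := fun x v => x ∈ f₂ (g v) ∧ h v ∈ f₁ x)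
      ((h₂ (diophFn_some hg) (proj_dioph none)).inter
        (h₁ (proj_dioph none) (diophFn_some hh)))).ext fun v => ?_
    exact Part.mem_bind_iff.symm
  | @prec f₁ f₂ _ _ h₁ h₂ =>
    intro α g h hg hh
    have ha := unpair_fst_diophFn hg
    have hn := unpair_snd_diophFn hg
    refine (exists_dioph (p := fun s v => Nat.beta s 0 ∈ f₁ (g v).unpair.1 ∧
      (∀ y < (g v).unpair.2, Nat.beta s (y + 1) ∈
        f₂ (Nat.pair (g v).unpair.1 (Nat.pair y (Nat.beta s y)))) ∧
      Nat.beta s (g v).unpair.2 = h v) ?_).ext fun v => ?_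
    · refine (h₁ (diophFn_some ha) (beta_diophFn (proj_dioph none) (const_dioph 0))).inter
        (Dioph.inter ?_ (eq_dioph (beta_diophFn (proj_dioph none) (diophFn_some hn))
          (diophFn_some hh)))
      refine forall_lt_dioph (p := fun y (w : Option α → ℕ) => Nat.beta (w none) (y + 1) ∈
        f₂ (Nat.pair (g fun x => w (some x)).unpair.1 (Nat.pair y (Nat.beta (w none) y))))
        ?_ (diophFn_some hn)
      have hs : DiophFn fun w : Option (Option α) → ℕ => w (some none) := proj_dioph _
      have hy : DiophFn fun w : Option (Option α) → ℕ => w none := proj_dioph _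
      exact h₂ (pair_diophFn (diophFn_some (diophFn_some ha)) (pair_diophFn hy (beta_diophFn hs hy)))
        (beta_diophFn hs (add_dioph hy (const_dioph 1)))
    · exact (mem_prec_iff f₁ f₂ _ _ _).symm
  | @rfind f₁ _ h₁ =>
    intro α g h hg hh
    refine ((h₁ (pair_diophFn hg hh) (const_dioph 0)).inter
      (forall_lt_dioph (p := fun k v => ∃ z, z ≠ 0 ∧ z ∈ f₁ (Nat.pair (g v) k))
        (exists_dioph (p := fun z (v : Option α → ℕ) => z ≠ 0 ∧
          z ∈ f₁ (Nat.pair (g fun x => v (some x)) (v none)))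
          ((ne_dioph (proj_dioph none) (const_dioph 0)).inter
            (h₁ (pair_diophFn (diophFn_some (diophFn_some hg)) (proj_dioph (some none)))
              (proj_dioph none)))) hh)).ext fun v => ?_
    refine Iff.trans ?_ Nat.mem_rfind.symm
    simp [Part.mem_map_iff, and_comm]

/-- Every recursively enumerable set of natural numbers is Diophantine. -/
theorem dioph_of_rePred {p : ℕ → Prop} (hp : REPred p) {α : Type} {g : (α → ℕ) → ℕ}
    (hg : DiophFn g) : Dioph {v | p (g v)} := by
  refine (dioph_of_partrec hp hg (const_dioph 0)).ext fun v => ?_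
  have : ∀ u : Unit, Encodable.encode u = 0 := fun _ => rfl
  simp [Part.mem_assert_iff, this]

/-! ### An interpreter for machine codes -/

/-- One step of the machine with the code `C` and first label `1`; the registers are a list. The
value is meaningful only if the program counter is a label of the machine. -/
def codeStep (C : List (ℕ × Option ℕ)) (σ : ℕ × List ℕ) : ℕ × List ℕ :=
  match C[σ.1 - 1]? with
  | none => σ
  | some (a, none) => (σ.1 + 1, σ.2.set a (σ.2.getD a 0 + 1))
  | some (a, some p) =>
    if σ.2.getD a 0 = 0 then (p, σ.2) else (σ.1 + 1, σ.2.set a (σ.2.getD a 0 - 1))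

/-- The machine with code `c`, started with the registers `l`, halts in `k` steps. -/
def HaltsAt (c : List (ℕ × Option ℕ)) (l : List ℕ) (k : ℕ) : Prop :=
  ((codeStep c)^[k] (1, l)).1 = 0 ∨ c.length + 1 ≤ ((codeStep c)^[k] (1, l)).1

theorem set_ofFn {n : ℕ} (v : Fin n → ℕ) (a : Fin n) (x : ℕ) :
    (List.ofFn v).set a x = List.ofFn (Function.update v a x) := by
  refine List.ext_getElem (by simp) fun i h₁ h₂ => ?_
  simp only [List.getElem_set, List.getElem_ofFn, Function.update_apply, Fin.ext_iff]
  simp [eq_comm]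

/-- The interpreter simulates the machine. -/
theorem codeStep_eq_of_step {n : ℕ} {P : List (Instr n)} {σ τ : State n} (h : Step 1 P σ τ) :
    codeStep (machineCode P) (σ.1, List.ofFn σ.2) = (τ.1, List.ofFn τ.2) := by
  cases h <;> simp_all [codeStep, machineCode, Instr.code, set_ofFn]

theorem exists_step {n : ℕ} {P : List (Instr n)} {σ : State n} (h : ¬ Out σ.1 1 P) :
    ∃ τ, Step 1 P σ τ := by
  obtain ⟨i, v⟩ := σ
  simp only [Out, not_or, not_lt, not_le] at h
  obtain ⟨k, rfl⟩ := Nat.exists_eq_add_of_le h.1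
  have hk : k < P.length := by omega
  cases hi : P[k] with
  | inc a => exact ⟨_, .inc (by rw [List.getElem?_eq_getElem hk, hi])⟩
  | dec a p =>
    have hi' : P[k]? = some (Instr.dec a p) := by rw [List.getElem?_eq_getElem hk, hi]
    cases hv : v a with
    | zero => exact ⟨_, .decZero hi' hv⟩
    | succ x => exact ⟨_, .decSucc hi' hv⟩

theorem terminates_iff_iterate {n : ℕ} {P : List (Instr n)} (σ : State n) :
    Terminates 1 P σ ↔
      ∃ k, Out ((codeStep (machineCode P))^[k] (σ.1, List.ofFn σ.2)).1 1 P := by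
  constructor
  · rintro ⟨τ, ⟨k, hk⟩, hτ⟩
    refine ⟨k, ?_⟩
    induction hk with
    | refl σ => exact hτ
    | head h _ ih =>
      rw [Function.iterate_succ_apply, codeStep_eq_of_step h]
      exact ih hτ
  · rintro ⟨k, hk⟩
    induction k generalizing σ with
    | zero => exact ⟨σ, ⟨0, .refl σ⟩, hk⟩
    | succ k ih =>
      by_cases h : Out σ.1 1 P
      · exact ⟨σ, ⟨0, .refl σ⟩, h⟩
      · obtain ⟨τ, hτ⟩ := exists_step h
        rw [Function.iterate_succ_apply, codeStep_eq_of_step hτ] at hk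
        obtain ⟨ρ, ⟨j, hj⟩, hρ⟩ := ih τ hk
        exact ⟨ρ, ⟨j + 1, .head hτ hj⟩, hρ⟩

theorem terminates_iff_haltsAt {n m : ℕ} (P : List (Instr (n + m))) (v : Fin n → ℕ) :
    Terminates 1 P (1, Fin.append v fun _ : Fin m => 0) ↔
      ∃ k, HaltsAt (machineCode P) (List.ofFn v ++ List.replicate m 0) k := by
  rw [terminates_iff_iterate]
  simp [HaltsAt, Out, List.ofFn_fin_append, machineCode, List.ofFn_const]

section

open Primrec

theorem primrec_codeStep : Primrec₂ codeStep := by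
  have hpc : Primrec fun x : List (ℕ × Option ℕ) × (ℕ × List ℕ) => x.2.1 := fst.comp snd
  have hget : Primrec fun x : List (ℕ × Option ℕ) × (ℕ × List ℕ) => x.1[x.2.1 - 1]? :=
    list_getElem?.comp fst (nat_sub.comp hpc (const 1))
  -- the arguments are the code, the state and the current instruction
  let A := (List (ℕ × Option ℕ) × (ℕ × List ℕ)) × (ℕ × Option ℕ)
  have hpc' : Primrec fun x : A => x.1.2.1 + 1 := succ.comp (hpc.comp fst)
  have hreg : Primrec fun x : A => x.1.2.2 := snd.comp (snd.comp fst)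
  have ha : Primrec fun x : A => x.2.1 := fst.comp snd
  have hval : Primrec fun x : A => x.1.2.2.getD x.2.1 0 := (list_getD 0).comp hreg ha
  have hinc := hpc'.pair (list_set.comp hreg (ha.pair (succ.comp hval)))
  have hdec : Primrec₂ fun (x : A) (p : ℕ) => if x.1.2.2.getD x.2.1 0 = 0 then (p, x.1.2.2) else
      (x.1.2.1 + 1, x.1.2.2.set x.2.1 (x.1.2.2.getD x.2.1 0 - 1)) :=
    ite (Primrec.eq.comp (hval.comp fst) (const 0)) (snd.pair (hreg.comp fst))
      ((hpc'.pair (list_set.comp hreg (ha.pair (pred.comp hval)))).comp fst)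
  refine (option_casesOn hget snd (option_casesOn (snd.comp snd) hinc hdec).to₂).of_eq fun x => ?_
  unfold codeStep
  rcases x.1[x.2.1 - 1]? with _ | ⟨a, _ | p⟩ <;> rfl

theorem primrec_replicate : Primrec₂ fun (m : ℕ) (x : ℕ) => List.replicate m x :=
  (list_map (g := fun x _ => x.2) (list_range.comp fst) (snd.comp fst).to₂).of_eq fun x => by simp

theorem primrecPred_haltsAt :
    PrimrecPred fun x : List (ℕ × Option ℕ) × List ℕ × ℕ => HaltsAt x.1 x.2.1 x.2.2 := by
  have h : Primrec fun x : List (ℕ × Option ℕ) × List ℕ × ℕ =>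
      ((codeStep x.1)^[x.2.2] (1, x.2.1)).1 :=
    fst.comp (nat_iterate (snd.comp snd) ((const 1).pair (fst.comp snd))
      (primrec_codeStep.comp (fst.comp fst) snd).to₂)
  exact (Primrec.eq.comp h (const 0)).or (nat_le.comp (succ.comp (list_length.comp fst)) h)

end

/-- Projections of primitive recursive relations are recursively enumerable, by unbounded search. -/
theorem rePred_exists {α β : Type} [Primcodable α] [Primcodable β] {p : α → β → Prop}
    (hp : PrimrecPred fun x : α × β => p x.1 x.2) : REPred fun a => ∃ b, p a b := by
  classical
  have hp := hp.decide
  have hq : Primrec₂ fun (a : α) (n : ℕ) =>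
      (Option.casesOn (decode (α := β) n) false fun b => decide (p a b) : Bool) :=
    Primrec.option_casesOn (Primrec.decode.comp .snd) (.const false)
      (hp.comp ((Primrec.fst.comp .fst).pair .snd)).to₂
  refine (Partrec.rfind (p := fun a n => Part.some _) hq.to_comp.partrec₂).dom_re.of_eq fun a => ?_
  refine Nat.rfind_dom.trans ?_
  constructor
  · rintro ⟨n, hn, -⟩
    cases hd : decode (α := β) n with
    | none => simp [hd] at hn
    | some b => exact ⟨b, by simpa [hd] using hn⟩
  · rintro ⟨b, hb⟩
    exact ⟨encode b, by simpa using hb, fun _ => trivial⟩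

/-! ### The universal halting problem -/

/-- A pairing function which is a polynomial with natural coefficients; it is injective but not
surjective. -/
def polyPair (a b : ℕ) : ℕ := (a + b) * (a + b) + a

theorem polyPair_inj {a b a' b' : ℕ} (h : polyPair a b = polyPair a' b') : a = a' ∧ b = b' := by
  unfold polyPair at h
  -- `polyPair a b` lies between the squares of `a + b` and `a + b + 1`
  have h1 : a + b = a' + b' := by
    rcases lt_trichotomy (a + b) (a' + b') with h1 | h1 | h1
    · nlinarith
    · exact h1
    · nlinarith
  rw [h1] at h
  omega

/-- Lists of a fixed length are coded by iterating `polyPair`. -/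
def polyTuple (l : List ℕ) : ℕ := l.foldr polyPair 0

theorem polyTuple_inj : ∀ {l l' : List ℕ}, l.length = l'.length → polyTuple l = polyTuple l' →
    l = l'
  | [], [], _, _ => rfl
  | a :: l, b :: l', hl, h => by
    obtain ⟨h1, h2⟩ := polyPair_inj h
    rw [h1, polyTuple_inj (l := l) (l' := l') (by simpa using hl) h2]

/-- `x` codes a machine together with an input on which it halts. -/
def UniversalHalts (x : ℕ) : Prop :=
  ∃ b : (ℕ × ℕ × List (ℕ × Option ℕ)) × List ℕ × ℕ,
    b.2.1.length = b.1.1 ∧ x = polyPair (encode b.1) (polyTuple b.2.1) ∧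
      HaltsAt b.1.2.2 (b.2.1 ++ List.replicate b.1.2.1 0) b.2.2

open Primrec in
theorem rePred_universalHalts : REPred UniversalHalts := by
  let A := ℕ × (ℕ × ℕ × List (ℕ × Option ℕ)) × List ℕ × ℕ
  have hpair : Primrec₂ polyPair := by
    have hs : Primrec fun x : ℕ × ℕ => x.1 + x.2 := nat_add
    exact nat_add.comp (nat_mul.comp hs hs) fst
  have htuple : Primrec polyTuple :=
    list_foldr .id (const 0) (hpair.comp (fst.comp snd) (snd.comp snd)).to₂
  have hb : Primrec fun x : A => x.2.1 := fst.comp snd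
  have hl : Primrec fun x : A => x.2.2.1 := fst.comp (snd.comp snd)
  have hk : Primrec fun x : A => x.2.2.2 := snd.comp (snd.comp snd)
  have hm : Primrec fun x : A => x.2.1.2.1 := fst.comp (snd.comp hb)
  have hc : Primrec fun x : A => x.2.1.2.2 := snd.comp (snd.comp hb)
  refine rePred_exists (.and ?_ (.and ?_ ?_))
  · exact Primrec.eq.comp (list_length.comp hl) (fst.comp hb)
  · exact Primrec.eq.comp fst (hpair.comp (Primrec.encode.comp hb) (htuple.comp hl))
  · exact primrecPred_haltsAt.comp (hc.pair
      ((list_append.comp hl (primrec_replicate.comp hm (const 0))).pair hk))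

theorem universalHalts_iff {n m : ℕ} (P : List (Instr (n + m))) (v : Fin n → ℕ) :
    UniversalHalts (polyPair (encode (n, m, machineCode P)) (polyTuple (List.ofFn v))) ↔
      Terminates 1 P (1, Fin.append v fun _ : Fin m => 0) := by
  rw [terminates_iff_haltsAt]
  constructor
  · rintro ⟨⟨c, l, k⟩, hl, hx, hk⟩
    obtain ⟨h1, h2⟩ := polyPair_inj hx
    obtain rfl := encode_injective h1
    obtain rfl := polyTuple_inj (by simpa using hl.symm) h2
    exact ⟨k, hk⟩
  · rintro ⟨k, hk⟩
    exact ⟨⟨(n, m, machineCode P), List.ofFn v, k⟩, by simp, rfl, hk⟩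

/-! ### The translation of machines into equations -/

/-- The polynomial which expresses `polyPair`. -/
def Poly.pair {U V : Type} (p q : Poly U V) : Poly U V := .add (.mul (.add p q) (.add p q)) p

/-- The polynomial which expresses `polyTuple` of the parameters in the list `l`. -/
def Poly.tuple {U V : Type} (l : List V) : Poly U V :=
  l.foldr (fun x p => .pair (.param x) p) (.const 0)

theorem Poly.eval_tuple {U V : Type} (l : List V) (v : V → ℕ) (w : U → ℕ) :
    (Poly.tuple l).eval v w = polyTuple (l.map v) := by
  induction l with
  | nil => rfl
  | cons x l ih =>
    change polyPair (v x) ((Poly.tuple l).eval v w) = _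
    rw [ih]
    rfl

/-- The number that codes the machine `P` and its input, as a polynomial in the input. -/
def inputPoly (k n m : ℕ) (P : List (Instr (n + m))) : Poly (Fin k) (Fin n) :=
  .pair (.const (encode (n, m, machineCode P))) (.tuple (List.finRange n))

/-- Insert the coded machine and input for the single parameter of the equation `E`. -/
def substTranslation {k : ℕ} (E : DioEq (Fin k) (Fin 1)) : Translation := fun n m P =>
  ⟨k, E.lhs.subst .var fun _ => inputPoly k n m P, E.rhs.subst .var fun _ => inputPoly k n m P⟩

theorem substTranslation_solvable {k : ℕ} (E : DioEq (Fin k) (Fin 1)) {n m : ℕ}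
    (P : List (Instr (n + m))) (v : Fin n → ℕ) :
    (substTranslation E n m P).2.Solvable v ↔
      E.Solvable fun _ => polyPair (encode (n, m, machineCode P)) (polyTuple (List.ofFn v)) := by
  have h : ∀ w : Fin k → ℕ, (inputPoly k n m P).eval v w =
      polyPair (encode (n, m, machineCode P)) (polyTuple (List.ofFn v)) := fun w => by
    rw [List.ofFn_eq_map, ← Poly.eval_tuple (List.finRange n) v w]
    rfl
  unfold DioEq.Solvable
  refine exists_congr fun (w : Fin k → ℕ) => ?_
  change (E.lhs.subst .var _).eval v w = (E.rhs.subst .var _).eval v w ↔ _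
  simp only [Poly.eval_subst, h]
  rfl

/-- The code of `Poly.pair` in terms of the codes of its arguments. -/
def pairCode (x y : List (ℕ × ℕ)) : List (ℕ × ℕ) :=
  (3, 0) :: (((4, 0) :: (((3, 0) :: (x ++ y)) ++ ((3, 0) :: (x ++ y)))) ++ x)

/-- The code of `Poly.tuple` in terms of the numbers of the parameters. -/
def tupleCode (l : List ℕ) : List (ℕ × ℕ) :=
  l.foldr (fun i y => pairCode [(1, i)] y) [(2, 0)]

theorem Poly.code_tuple {k n : ℕ} (l : List (Fin n)) :
    (Poly.tuple l : Poly (Fin k) (Fin n)).code = tupleCode (l.map Fin.val) := by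
  induction l with
  | nil => rfl
  | cons x l ih =>
    change pairCode [(1, (x : ℕ))] (Poly.tuple l).code = _
    rw [ih]
    rfl

/-- Substituting a polynomial for the parameters replaces the symbols `(1, x)` in prefix notation. -/
theorem Poly.code_subst {k n l : ℕ} (p : Poly (Fin k) (Fin l)) (q : Poly (Fin k) (Fin n)) :
    (p.subst .var fun _ => q).code = p.code.flatMap fun s => if s.1 = 1 then q.code else [s] := by
  induction p <;> simp_all [Poly.subst, Poly.code]

open Primrec in
theorem primrec_pairCode : Primrec₂ pairCode := by
  have hs : Primrec fun x : List (ℕ × ℕ) × List (ℕ × ℕ) => ((3, 0) : ℕ × ℕ) :: (x.1 ++ x.2) :=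
    list_cons.comp (const _) list_append
  have hm : Primrec fun x : List (ℕ × ℕ) × List (ℕ × ℕ) => ((4, 0) : ℕ × ℕ) ::
      (((3, 0) :: (x.1 ++ x.2)) ++ ((3, 0) :: (x.1 ++ x.2))) :=
    list_cons.comp (const _) (list_append.comp hs hs)
  exact list_cons.comp (const ((3, 0) : ℕ × ℕ)) (list_append.comp hm fst)

open Primrec in
theorem primrec_singleton (a : ℕ) : Primrec fun i : ℕ => [(a, i)] :=
  list_cons.comp ((const a).pair .id) (const [])

open Primrec in
theorem primrec_tupleCode : Primrec tupleCode :=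
  list_foldr (h := fun _ x => pairCode [(1, x.1)] x.2) .id (const [((2, 0) : ℕ × ℕ)])
    (primrec_pairCode.comp ((primrec_singleton 1).comp (fst.comp snd)) (snd.comp snd)).to₂

open Primrec in
theorem primrec_substCode {α : Type} [Primcodable α] {X : α → List (ℕ × ℕ)} (hX : Primrec X)
    (l : List (ℕ × ℕ)) : Primrec fun x => l.flatMap fun s => if s.1 = 1 then X x else [s] :=
  list_flatMap (g := fun x s => if s.1 = 1 then X x else [s]) (const l)
    (ite (Primrec.eq.comp (fst.comp snd) (const 1)) (hX.comp fst)
      (list_cons.comp snd (const []))).to₂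

/-- The code of `inputPoly` as a function of `n`, `m` and the code of the machine. -/
def inputCode (x : ℕ × ℕ × List (ℕ × Option ℕ)) : List (ℕ × ℕ) :=
  pairCode [(2, encode x)] (tupleCode (List.range x.1))

theorem code_inputPoly (k n m : ℕ) (P : List (Instr (n + m))) :
    (inputPoly k n m P).code = inputCode (n, m, machineCode P) := by
  change pairCode _ (Poly.tuple (List.finRange n)).code = _
  rw [Poly.code_tuple, List.map_coe_finRange_eq_range]
  rfl

open Primrec in
theorem primrec_inputCode : Primrec inputCode :=
  primrec_pairCode.comp ((primrec_singleton 2).comp Primrec.encode)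
    (primrec_tupleCode.comp (list_range.comp fst))

theorem substTranslation_isComputable {k : ℕ} (E : DioEq (Fin k) (Fin 1)) :
    (substTranslation E).IsComputable := by
  have h : Primrec fun x => (k, E.lhs.code.flatMap (fun s => if s.1 = 1 then inputCode x else [s]),
      E.rhs.code.flatMap fun s => if s.1 = 1 then inputCode x else [s]) :=
    (Primrec.const k).pair ((primrec_substCode primrec_inputCode _).pair
      (primrec_substCode primrec_inputCode _))
  refine ⟨_, h.to_comp, fun n m P => ?_⟩
  simp only [← code_inputPoly k, substTranslation, Poly.code_subst]

end DPRM

theorem mainTheorem2 :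
    (∀ (n : ℕ) (R : (Fin n → ℕ) → Prop), DPRM.MMRecognisable R → DPRM.Diophantine R) ∧
    ∃ F : DPRM.Translation, F.IsComputable ∧
      ∀ (n m : ℕ) (P : List (DPRM.Instr (n + m))) (R : (Fin n → ℕ) → Prop),
        DPRM.Recognises P R → ∀ v : Fin n → ℕ, R v ↔ (F n m P).2.Solvable v := by
  obtain ⟨k, E, hE⟩ := DPRM.exists_dioEq_of_dioph
    (DPRM.dioph_of_rePred DPRM.rePred_universalHalts (Dioph.proj_dioph (0 : Fin 1)))
  have hF : ∀ (n m : ℕ) (P : List (DPRM.Instr (n + m))) (R : (Fin n → ℕ) → Prop),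
      DPRM.Recognises P R →
        ∀ v : Fin n → ℕ, R v ↔ (DPRM.substTranslation E n m P).2.Solvable v :=
    fun n m P R hP v => by
      rw [hP v, DPRM.substTranslation_solvable, ← hE, ← DPRM.universalHalts_iff]
      rfl
  exact ⟨fun n R ⟨m, P, hP⟩ => ⟨_, _, hF n m P R hP⟩,
    DPRM.substTranslation E, DPRM.substTranslation_isComputable E, hF⟩
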